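/- Let $n\ge 3$. There is a generic $K_n$-free graph on the vertex set $\mathbb N$, and every countable generic $K_n$-free graph $\Gamma_n$ satisfies the following. The isomorphism relation on the space of $K_n$-free graphs with vertex set $\mathbb N$ is Borel reducible to the conjugacy relation on $\operatorname{Aut}(\Gamma_n)$. Moreover, the conjugacy relation on $\operatorname{Aut}(\Gamma_n)$ is Borel complete. Here a graph is simple and undirected, and is $K_n$-free if it has no complete subgraph on $n$ vertices. A countable graph $\Gamma$ is a generic $K_n$-free graph if it is homogeneous (every isomorphism between finite induced subgraphs of $\Gamma$ extends to an automorphism of $\Gamma$) and its finite induced subgraphs are, up to isomorphism, exactly the finite $K_n$-free graphs. The space of $K_n$-free graphs on $\mathbb N$ has the Borel structure generated by the sets $\{G : a \text{ is adjacent to } b \text{ in } G\}$ with $a,b\in\mathbb N$, and $\operatorname{Aut}(\Gamma_n)$ has the Borel structure of the topology of pointwise convergence, generated by the sets $\{\varphi : \varphi(a)=b\}$ with $a,b$ vertices of $\Gamma_n$; both are standard Borel spaces. For equivalence relations $E,F$ on standard Borel spaces $X,Y$, $E$ is Borel reducible to $F$ if there is a Borel map $f\colon X\to Y$ such that $x\mathrel{E}x'\iff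 f(x)\mathrel{F}f(x')$ for all $x,x'\in X$. An equivalence relation $E$ on a standard Borel space is Borel complete if for every countable relational language $\mathcal L=\{R_i\}$, with $R_i$ of arity $n_i$, and every Borel set $C$ in the space $\mathrm{Mod}_{\mathcal L}=\prod_i\mathcal P(\mathbb N^{n_i})$ of $\mathcal L$-structures with universe $\mathbb N$, the isomorphism relation on $C$ is Borel reducible to $E$. -/

import Mathlib

open scoped FirstOrder

/-! ### Borel reducibility -/

/-- `E ≤_B F` for equivalence relations `E`, `F` on standard Borel spaces: there is a Borel map `f`
with `x E x' ↔ f x F f x'`. -/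
def BorelReducible {X Y : Type*} [MeasurableSpace X] [StandardBorelSpace X]
    [MeasurableSpace Y] [StandardBorelSpace Y] (E : Setoid X) (F : Setoid Y) : Prop :=
  ∃ f : X → Y, Measurable f ∧ ∀ x x' : X, E x x' ↔ F (f x) (f x')

/-- A measurable space whose σ-algebra is pulled back along an injection with Borel range into a
standard Borel space is standard Borel. -/
theorem standardBorelSpace_of_comap {α β : Type*} [mα : MeasurableSpace α] [mβ : MeasurableSpace β]
    [StandardBorelSpace β] (f : α → β) (hm : mα = mβ.comap f) (hf : Function.Injective f)
    (hr : MeasurableSet (Set.range f)) : StandardBorelSpace α := by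
  have : StandardBorelSpace (Set.range f) := hr.standardBorel
  obtain ⟨τ, hb, hp⟩ := StandardBorelSpace.polish (α := Set.range f)
  let e : α ≃ Set.range f := Equiv.ofInjective f hf
  let : TopologicalSpace α := τ.induced e
  have he : Topology.IsInducing e := ⟨rfl⟩
  let h : α ≃ₜ Set.range f := e.toHomeomorphOfIsInducing he
  have : PolishSpace α := h.isClosedEmbedding.polishSpace
  have : BorelSpace α := ⟨by
    have h1 : mα = (Subtype.instMeasurableSpace : MeasurableSpace (Set.range f)).comap e := by
      rw [hm, Subtype.instMeasurableSpace, MeasurableSpace.comap_comp]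
      rfl
    rw [h1, hb.measurable_eq, borel_comap]⟩
  infer_instance

/-! ### The space of countable structures -/

/-- The space `Mod_L = ∏_R 𝒫(ℕ^k)` of `L`-structures with universe `ℕ`, for a relational
language `L`; the product is over all relation symbols `R` of `L`, and `k` is the arity of `R`. -/
def ModSpace (L : FirstOrder.Language.{0, 0}) : Type :=
  (R : Σ k : ℕ, L.Relations k) → Set (Fin R.1 → ℕ)

namespace ModSpace

variable {L : FirstOrder.Language.{0, 0}}

/-- The product σ-algebra, each factor `𝒫(ℕ^k)` carrying the Borel sets of the Cantor topology
(generated by the sets `{A | a ∈ A}`). For a countable language these are the Borel sets of the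
product topology. -/
instance : MeasurableSpace (ModSpace L) :=
  inferInstanceAs (MeasurableSpace ((R : Σ k : ℕ, L.Relations k) → Set (Fin R.1 → ℕ)))

instance [Countable (Σ k : ℕ, L.Relations k)] : StandardBorelSpace (ModSpace L) :=
  inferInstanceAs (StandardBorelSpace
    ((R : Σ k : ℕ, L.Relations k) → (Fin R.1 → ℕ) → Prop))

/-- The structure on `ℕ` coded by a point of `Mod_L`. -/
@[reducible]
def toStructure [L.IsRelational] (x : ModSpace L) : L.Structure ℕ where
  RelMap {k} R a := a ∈ x ⟨k, R⟩

/-- Isomorphism of `L`-structures, on a class `C` of structures with universe `ℕ`. -/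
def isoOn [L.IsRelational] (C : Set (ModSpace L)) : Setoid C where
  r x y := Nonempty (@FirstOrder.Language.Equiv L ℕ ℕ x.1.toStructure y.1.toStructure)
  iseqv :=
    { refl := fun x => ⟨@FirstOrder.Language.Equiv.refl L ℕ x.1.toStructure⟩
      symm := fun {x y} ⟨e⟩ =>
        ⟨@FirstOrder.Language.Equiv.symm L ℕ ℕ x.1.toStructure y.1.toStructure e⟩
      trans := fun {x y z} ⟨e⟩ ⟨f⟩ =>
        ⟨@FirstOrder.Language.Equiv.comp L ℕ ℕ x.1.toStructure y.1.toStructure ℕ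
          z.1.toStructure f e⟩ }

end ModSpace

/-- An equivalence relation `E` on a standard Borel space is Borel complete if, for every countable
relational language `L` and every Borel class `C` of `L`-structures with universe `ℕ`, isomorphism
on `C` is Borel reducible to `E`. -/
def BorelComplete {X : Type*} [MeasurableSpace X] [StandardBorelSpace X] (E : Setoid X) : Prop :=
  ∀ (L : FirstOrder.Language.{0, 0}) [L.IsRelational] [Countable (Σ k : ℕ, L.Relations k)]
    (C : Set (ModSpace L)) (hC : MeasurableSet C),
    haveI : StandardBorelSpace C := hC.standardBorel
    BorelReducible (ModSpace.isoOn C) E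

/-! ### Countable graphs without complete subgraphs on `n` vertices -/

/-- The space of `K_n`-free graphs with vertex set `ℕ`. Its Borel structure is inherited from
the space `SimpleGraph ℕ`, whose σ-algebra is generated by the sets `{G | G.Adj a b}`. -/
abbrev KFreeGraph (n : ℕ) : Type := {G : SimpleGraph ℕ // G.CliqueFree n}

instance : StandardBorelSpace (SimpleGraph ℕ) := by
  refine standardBorelSpace_of_comap (SimpleGraph.Adj : SimpleGraph ℕ → ℕ → ℕ → Prop) rfl
    (fun G H h => SimpleGraph.ext h) ?_
  have : Set.range (SimpleGraph.Adj : SimpleGraph ℕ → ℕ → ℕ → Prop) =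
      {r | (∀ a b, r a b → r b a) ∧ ∀ a, ¬ r a a} := by
    ext r
    constructor
    · rintro ⟨G, rfl⟩
      exact ⟨fun a b h => h.symm, fun a h => G.ne_of_adj h rfl⟩
    · rintro ⟨h1, h2⟩
      exact ⟨{ Adj := r, symm := ⟨h1⟩, loopless := ⟨h2⟩ }, rfl⟩
  rw [this]
  have hm (a b : ℕ) : Measurable fun r : ℕ → ℕ → Prop => r a b :=
    (measurable_pi_apply b).comp (measurable_pi_apply a)
  refine measurableSet_setOfPred.2 (Measurable.and ?_ ?_)
  · exact Measurable.forall fun a => Measurable.forall fun b => (hm a b).imp (hm b a)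
  · exact Measurable.forall fun a => (hm a a).not

theorem measurableSet_cliqueFree (n : ℕ) : MeasurableSet {G : SimpleGraph ℕ | G.CliqueFree n} := by
  have hm (a b : ℕ) : Measurable fun G : SimpleGraph ℕ => G.Adj a b :=
    SimpleGraph.measurable_iff_adj.1 measurable_id a b
  have : {G : SimpleGraph ℕ | G.CliqueFree n} = {G | ∀ s : Finset ℕ,
      ¬ ((∀ a b, a ∈ s → b ∈ s → a ≠ b → G.Adj a b) ∧ s.card = n)} := by
    ext G
    simp only [SimpleGraph.CliqueFree, SimpleGraph.isNClique_iff, SimpleGraph.isClique_iff,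
      Set.mem_ofPred_eq, Set.Pairwise, Finset.mem_coe]
    refine forall_congr' fun s => not_congr (and_congr_left fun _ => ?_)
    exact ⟨fun h a b ha hb => h ha hb, fun h a ha b hb => h a b ha hb⟩
  rw [this]
  refine measurableSet_setOfPred.2 (Measurable.forall fun s => (Measurable.and ?_ measurable_const).not)
  exact Measurable.forall fun a => Measurable.forall fun b =>
    measurable_const.imp (measurable_const.imp (measurable_const.imp (hm a b)))

instance (n : ℕ) : StandardBorelSpace (KFreeGraph n) := (measurableSet_cliqueFree n).standardBorel

/-- Isomorphism of `K_n`-free graphs with vertex set `ℕ`. -/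
def kFreeIso (n : ℕ) : Setoid (KFreeGraph n) where
  r G H := Nonempty (G.1 ≃g H.1)
  iseqv :=
    { refl := fun _ => ⟨SimpleGraph.Iso.refl⟩
      symm := fun ⟨e⟩ => ⟨e.symm⟩
      trans := fun ⟨e⟩ ⟨f⟩ => ⟨e.trans f⟩ }

/-- `Γ` is generic for the class of finite `K_n`-free graphs: it is homogeneous (every isomorphism
between finite induced subgraphs extends to an automorphism), and its finite induced subgraphs are,
up to isomorphism, exactly the finite `K_n`-free graphs. -/
structure IsGenericKFree {V : Type*} (n : ℕ) (Γ : SimpleGraph V) : Prop where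
  homogeneous : ∀ (S : Finset V) (f : Γ.induce (S : Set V) ↪g Γ),
    ∃ φ : Γ ≃g Γ, ∀ s : (S : Set V), φ s = f s
  age : ∀ (k : ℕ) (H : SimpleGraph (Fin k)), Nonempty (H ↪g Γ) ↔ H.CliqueFree n

/-! ### The conjugacy relation on the automorphism group of a countable graph -/

/-- The Borel sets of the topology of pointwise convergence on the automorphism group of a
countable graph, generated by the sets `{φ | φ a = b}`. -/
instance autMeasurableSpace {V : Type*} (Γ : SimpleGraph V) : MeasurableSpace (Γ ≃g Γ) :=
  (@MeasurableSpace.pi V (fun _ => V) (fun _ => ⊤)).comap fun φ v => φ v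

instance {V : Type*} [Countable V] (Γ : SimpleGraph V) : StandardBorelSpace (Γ ≃g Γ) := by
  let : MeasurableSpace V := ⊤
  have : DiscreteMeasurableSpace V := ⟨fun _ => trivial⟩
  refine standardBorelSpace_of_comap (fun (φ : Γ ≃g Γ) v => φ v) rfl
    (fun φ ψ h => RelIso.ext fun v => congrFun h v) ?_
  have : Set.range (fun (φ : Γ ≃g Γ) v => φ v) = {p : V → V |
      ((∀ a b, p a = p b → a = b) ∧ ∀ b, ∃ a, p a = b) ∧
        ∀ a b, Γ.Adj (p a) (p b) ↔ Γ.Adj a b} := by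
    ext p
    constructor
    · rintro ⟨φ, rfl⟩
      exact ⟨⟨fun a b h => φ.injective h, φ.surjective⟩, fun a b => φ.map_rel_iff⟩
    · rintro ⟨⟨h1, h2⟩, h3⟩
      exact ⟨⟨Equiv.ofBijective p ⟨fun a b h => h1 a b h, h2⟩, fun {a b} => h3 a b⟩, rfl⟩
  rw [this]
  have hm (P : V → V → Prop) (a b : V) : Measurable fun p : V → V => P (p a) (p b) :=
    Measurable.comp (g := fun q : V × V => P q.1 q.2) (f := fun p : V → V => (p a, p b))
      Measurable.of_discrete ((measurable_pi_apply a).prodMk (measurable_pi_apply b))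
  refine measurableSet_setOfPred.2 (Measurable.and (Measurable.and ?_ ?_) ?_)
  · exact Measurable.forall fun a => Measurable.forall fun b =>
      (hm (fun x y => x = y) a b).imp measurable_const
  · exact Measurable.forall fun b => Measurable.exists fun a => hm (fun x _ => x = b) a a
  · exact Measurable.forall fun a => Measurable.forall fun b =>
      (hm Γ.Adj a b).iff measurable_const

/-- The conjugacy relation on `Aut(Γ)`. -/
def autConj {V : Type*} (Γ : SimpleGraph V) : Setoid (Γ ≃g Γ) := IsConj.setoid (Γ ≃g Γ)

/-! Over every $K_n$-free graph $G$ on $\mathbb N$ one builds a generic $K_n$-free graph with an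
involution whose fixed points induce exactly $G$. Its vertices are names: the vertices of $G$, and
finite lists of names, built hereditarily, with a Boolean flag at every node and a numerical index.
A list name is joined to the members of its list, provided these contain no $(n-1)$-clique. This
realises every one-point extension (`Tower.hasKFreeExtension_graph`) without creating a $K_n$
(`Tower.cliqueFree_graph`). Negating all flags is an automorphism that fixes only the vertices of
$G$.

For countable $K_n$-free graphs the extension property is equivalent to genericity, and
back-and-forth makes any two of them isomorphic. Each step is a choice from a countable set, so an
isomorphism $\theta_G$ from the tower over $G$ to $\Gamma$ can be chosen in a Borel way
(`exists_measurable_iso`). The reduction sends $G$ to the flip transported by $\theta_G$: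
isomorphisms of base graphs lift to towers and commute with the flips, while a conjugacy of flips
restricts to their fixed points.

For Borel completeness, a structure is coded by a triangle-free graph with a proper vertex
colouring, and the colours by hubs that are recognised by their numbers of leaves. The result is
triangle-free, hence $K_n$-free for $n\ge 3$. -/

/-! ### Measurable back-and-forth -/

/-- The one-point extension property of the generic `K_n`-free graph. -/
def HasKFreeExtension {V : Type*} (n : ℕ) (Γ : SimpleGraph V) : Prop :=
  ∀ A B : Finset V, Disjoint A B → (∀ s ⊆ A, ¬ Γ.IsNClique (n - 1) s) →
    ∃ v, v ∉ B ∧ (∀ a ∈ A, Γ.Adj v a) ∧ ∀ b ∈ B, ¬ Γ.Adj v b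

/-- A finite set of pairs is a partial isomorphism between two graphs. -/
def IsPartialIso {W V : Type*} (G : SimpleGraph W) (H : SimpleGraph V) (p : Finset (W × V)) :
    Prop :=
  ∀ a ∈ p, ∀ b ∈ p, (a.1 = b.1 ↔ a.2 = b.2) ∧ (G.Adj a.1 b.1 ↔ H.Adj a.2 b.2)

namespace IsPartialIso

variable {W V : Type*} {G : SimpleGraph W} {H : SimpleGraph V} {p : Finset (W × V)}

theorem swap (hp : IsPartialIso G H p) :
    IsPartialIso H G (p.map (Equiv.prodComm W V).toEmbedding) := by
  intro a ha b hb
  simp only [Finset.mem_map_equiv] at ha hb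
  exact ⟨(hp _ ha _ hb).1.symm, (hp _ ha _ hb).2.symm⟩

/-- The image of `w` must be joined to the images of the neighbours of `w` and to no other point of
the range. The extension property applies because an $(n-1)$-clique among those images would pull
back to one among the neighbours of `w`, and adding `w` would give a $K_n$ in `G`. -/
theorem exists_extend {n : ℕ} (hn : 1 ≤ n) (hG : G.CliqueFree n) (hH : HasKFreeExtension n H)
    (hp : IsPartialIso G H p) (w : W) :
    ∃ q, p ⊆ q ∧ IsPartialIso G H q ∧ ∃ v, (w, v) ∈ q := by
  classical
  by_cases hw : ∃ v, (w, v) ∈ p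
  · exact ⟨p, subset_rfl, hp, hw⟩
  have hA (v : V) : v ∈ (p.filter fun a => G.Adj w a.1).image Prod.snd ↔
      ∃ u, (u, v) ∈ p ∧ G.Adj w u := by simp
  have hB (v : V) : v ∈ (p.filter fun a => ¬ G.Adj w a.1).image Prod.snd ↔
      ∃ u, (u, v) ∈ p ∧ ¬ G.Adj w u := by simp
  obtain ⟨v, hv, hvA, hvB⟩ := hH _ ((p.filter fun a => ¬ G.Adj w a.1).image Prod.snd)
    (Finset.disjoint_left.2 fun v h1 h2 => by
      obtain ⟨u, hu, hwu⟩ := (hA v).1 h1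
      obtain ⟨u', hu', hwu'⟩ := (hB v).1 h2
      obtain rfl : u = u' := (hp _ hu _ hu').1.2 rfl
      exact hwu' hwu)
    (by
      intro s hs hc
      have : ∀ v : s, ∃ u, (u, v.1) ∈ p ∧ G.Adj w u := fun v => (hA v).1 (hs v.2)
      choose g hg hwg using this
      have hinj : Function.Injective g := fun a b hab =>
        Subtype.ext ((hp _ (hg a) _ (hg b)).1.1 hab)
      have ht : G.IsNClique (n - 1) (Finset.univ.image g) := by
        refine ⟨?_, ?_⟩
        · rw [SimpleGraph.isClique_iff]
          intro a ha b hb hab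
          simp only [Finset.coe_image, Finset.coe_univ, Set.image_univ, Set.mem_range] at ha hb
          obtain ⟨a, rfl⟩ := ha
          obtain ⟨b, rfl⟩ := hb
          exact (hp _ (hg a) _ (hg b)).2.2
            (hc.1 a.2 b.2 fun h => hab (congrArg g (Subtype.ext h)))
        · rw [Finset.card_image_of_injective _ hinj, Finset.card_univ, Fintype.card_coe, hc.2]
      have := ht.insert (a := w) fun b hb => by
        obtain ⟨x, -, rfl⟩ := Finset.mem_image.1 hb
        exact hwg x
      rw [Nat.sub_add_cancel hn] at this
      exact hG _ this)
  have hne (u : W) (x : V) (h : (u, x) ∈ p) : ¬ w = u ∧ ¬ v = x ∧ (G.Adj w u ↔ H.Adj v x) := by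
    refine ⟨fun e => hw ⟨x, e ▸ h⟩, ?_⟩
    by_cases hwu : G.Adj w u
    · have := hvA x ((hA x).2 ⟨u, h, hwu⟩)
      exact ⟨this.ne, iff_of_true hwu this⟩
    · have hx := (hB x).2 ⟨u, h, hwu⟩
      exact ⟨fun e => hv (e ▸ hx), iff_of_false hwu (hvB x hx)⟩
  refine ⟨insert (w, v) p, Finset.subset_insert _ _, ?_, v, Finset.mem_insert_self _ _⟩
  rintro ⟨a, a'⟩ ha ⟨b, b'⟩ hb
  simp only [Finset.mem_insert, Prod.mk.injEq] at ha hb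
  rcases ha with ⟨rfl, rfl⟩ | ha <;> rcases hb with ⟨rfl, rfl⟩ | hb
  · simp
  · have := hne _ _ hb
    exact ⟨iff_of_false this.1 this.2.1, this.2.2⟩
  · have := hne _ _ ha
    exact ⟨iff_of_false (Ne.symm this.1) (Ne.symm this.2.1),
      by simpa only [SimpleGraph.adj_comm] using this.2.2⟩
  · exact hp _ ha _ hb

theorem exists_extend_symm {n : ℕ} (hn : 1 ≤ n) (hH : H.CliqueFree n)
    (hG : HasKFreeExtension n G) (hp : IsPartialIso G H p) (v : V) :
    ∃ q, p ⊆ q ∧ IsPartialIso G H q ∧ ∃ w, (w, v) ∈ q := by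
  obtain ⟨q, hpq, hq, w, hw⟩ := hp.swap.exists_extend hn hH hG v
  refine ⟨q.map (Equiv.prodComm V W).toEmbedding, fun a ha => ?_, hq.swap, w, ?_⟩
  · rw [Finset.mem_map_equiv]
    exact hpq (by simpa [Finset.mem_map_equiv] using ha)
  · rw [Finset.mem_map_equiv]
    exact hw

end IsPartialIso

/-- Measurable uniformization of a relation with countable discrete second coordinate. -/
theorem exists_measurable_choice {X Y : Type*} [MeasurableSpace X] [MeasurableSpace Y]
    [Countable Y] {R : X → Y → Prop} (hR : ∀ y, MeasurableSet {x | R x y}) (h : ∀ x, ∃ y, R x y) :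
    ∃ f : X → Y, Measurable f ∧ ∀ x, R x (f x) := by
  classical
  rcases isEmpty_or_nonempty X with hX | ⟨⟨x₀⟩⟩
  · exact ⟨fun x => isEmptyElim x, measurable_of_empty _, fun x => isEmptyElim x⟩
  have : Nonempty Y := ⟨(h x₀).choose⟩
  obtain ⟨e, he⟩ := exists_surjective_nat Y
  have h' (x : X) : ∃ k, R x (e k) := by
    obtain ⟨y, hy⟩ := h x
    obtain ⟨k, rfl⟩ := he y
    exact ⟨k, hy⟩
  -- The first admissible value in a fixed enumeration of `Y` depends measurably on `x`.
  exact ⟨fun x => e (Nat.find (h' x)),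
    (measurable_from_top (f := e)).comp (measurable_find h' fun k => hR (e k)),
    fun x => Nat.find_spec (h' x)⟩

/-- Measurable back-and-forth: isomorphisms between the members of a measurable family of
countable `K_n`-free graphs with the extension property and a fixed such graph can be chosen
measurably, extending a given partial isomorphism. -/
theorem exists_measurable_iso {X W V : Type*} [MeasurableSpace X] [Countable W] [Countable V]
    {n : ℕ} (hn : 2 ≤ n) (G : X → SimpleGraph W) (H : SimpleGraph V)
    (hGm : ∀ a b, MeasurableSet {x | (G x).Adj a b})
    (hGc : ∀ x, (G x).CliqueFree n) (hHc : H.CliqueFree n)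
    (hG : ∀ x, HasKFreeExtension n (G x)) (hH : HasKFreeExtension n H)
    (p : Finset (W × V)) (hp : ∀ x, IsPartialIso (G x) H p) :
    ∃ θ : ∀ x, G x ≃g H, (∀ x, ∀ a ∈ p, θ x a.1 = a.2) ∧
      ∀ w v, MeasurableSet {x | θ x w = v} := by
  classical
  let P := Finset (W × V)
  let : MeasurableSpace P := ⊤
  let : MeasurableSpace (W ⊕ V) := ⊤
  have hPIm (q : P) : MeasurableSet {x | IsPartialIso (G x) H q} := by
    refine measurableSet_setOfPred.2 (Measurable.forall fun a => Measurable.imp measurable_const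
      (Measurable.forall fun b => Measurable.imp measurable_const
        (Measurable.and measurable_const (Measurable.iff ?_ measurable_const))))
    exact measurableSet_setOfPred.1 (hGm _ _)
  -- A task is a point of `W` to be put in the domain or a point of `V` to be put in the range. The
  -- step function below is total: where its input is not a partial isomorphism nothing is required
  -- of it.
  let T (t : W ⊕ V) (q : P) : Prop :=
    Sum.elim (fun w => ∃ v, (w, v) ∈ q) (fun v => ∃ w, (w, v) ∈ q) t
  have hstep : ∃ s : X × P × (W ⊕ V) → P, Measurable s ∧ ∀ y, (IsPartialIso (G y.1) H y.2.1 →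
      y.2.1 ⊆ s y ∧ IsPartialIso (G y.1) H (s y) ∧ T y.2.2 (s y)) := by
    refine exists_measurable_choice (R := fun (y : X × P × (W ⊕ V)) (q : P) =>
      IsPartialIso (G y.1) H y.2.1 → y.2.1 ⊆ q ∧ IsPartialIso (G y.1) H q ∧ T y.2.2 q) ?_ ?_
    · intro q
      -- There are only countably many pairs of a finite map and a task, so measurability may be
      -- checked on each slice.
      have key : {y : X × P × (W ⊕ V) | IsPartialIso (G y.1) H y.2.1 →
          y.2.1 ⊆ q ∧ IsPartialIso (G y.1) H q ∧ T y.2.2 q} =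
          ⋃ r : P × (W ⊕ V), {x | IsPartialIso (G x) H r.1 →
            r.1 ⊆ q ∧ IsPartialIso (G x) H q ∧ T r.2 q} ×ˢ {r} := by
        ext ⟨x, r⟩
        simp
      rw [key]
      refine MeasurableSet.iUnion fun r => MeasurableSet.prod ?_ (measurableSet_singleton r)
      refine measurableSet_setOfPred.2 (Measurable.imp ?_ (Measurable.and measurable_const
        (Measurable.and ?_ measurable_const)))
      · exact measurableSet_setOfPred.1 (hPIm _)
      · exact measurableSet_setOfPred.1 (hPIm _)
    · rintro ⟨x, r, t⟩
      by_cases hr : IsPartialIso (G x) H r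
      · rcases t with w | v
        · obtain ⟨q, hq⟩ := hr.exists_extend (by omega) (hGc x) hH w
          exact ⟨q, fun _ => hq⟩
        · obtain ⟨q, hq⟩ := hr.exists_extend_symm (by omega) hHc (hG x) v
          exact ⟨q, fun _ => hq⟩
      · exact ⟨∅, fun h => (hr h).elim⟩
  obtain ⟨s, hsm, hs⟩ := hstep
  -- This uses $n\ge 2$: for $n=1$ the empty set would be an $(n-1)$-clique.
  have : Nonempty (W ⊕ V) := by
    obtain ⟨v, -⟩ := hH ∅ ∅ (Finset.disjoint_empty_left _) (by
      intro t ht hc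
      have := hc.2
      rw [Finset.subset_empty.1 ht, Finset.card_empty] at this
      omega)
    exact ⟨Sum.inr v⟩
  obtain ⟨e, he⟩ := exists_surjective_nat (W ⊕ V)
  let q (k : ℕ) (x : X) : P := Nat.rec p (fun k r => s (x, r, e k)) k
  have hqs (k : ℕ) (x : X) : q (k + 1) x = s (x, q k x, e k) := rfl
  have hqm (k : ℕ) : Measurable (q k) := by
    induction k with
    | zero => exact measurable_const
    | succ k ih => exact hsm.comp (measurable_id.prodMk (ih.prodMk measurable_const))
  have hq (k : ℕ) (x : X) : IsPartialIso (G x) H (q k x) := by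
    induction k with
    | zero => exact hp x
    | succ k ih => exact (hs (x, q k x, e k) ih).2.1
  have hmono (x : X) : Monotone fun k => q k x :=
    monotone_nat_of_le_succ fun k => (hs (x, q k x, e k) (hq k x)).1
  have hT (x : X) (t : W ⊕ V) : ∃ k, T t (q k x) := by
    obtain ⟨k, rfl⟩ := he t
    exact ⟨k + 1, (hs (x, q k x, e k) (hq k x)).2.2⟩
  have hcompat (x : X) {a b : W × V} {k l : ℕ} (ha : a ∈ q k x) (hb : b ∈ q l x) :
      (a.1 = b.1 ↔ a.2 = b.2) ∧ ((G x).Adj a.1 b.1 ↔ H.Adj a.2 b.2) :=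
    hq (max k l) x _ (hmono x (le_max_left k l) ha) _ (hmono x (le_max_right k l) hb)
  choose f hf using fun (x : X) (w : W) => show ∃ v k, (w, v) ∈ q k x by
    obtain ⟨k, v, h⟩ := hT x (Sum.inl w)
    exact ⟨v, k, h⟩
  choose g hg using fun (x : X) (v : V) => show ∃ w k, (w, v) ∈ q k x by
    obtain ⟨k, w, h⟩ := hT x (Sum.inr v)
    exact ⟨w, k, h⟩
  have hfiff (x : X) (w : W) (v : V) : f x w = v ↔ ∃ k, (w, v) ∈ q k x := by
    obtain ⟨k, hk⟩ := hf x w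
    constructor
    · rintro rfl
      exact ⟨k, hk⟩
    · rintro ⟨l, hl⟩
      exact (hcompat x hk hl).1.1 rfl
  refine ⟨fun x => ⟨⟨f x, g x, ?_, ?_⟩, ?_⟩, ?_, ?_⟩
  · intro w
    obtain ⟨k, hk⟩ := hf x w
    obtain ⟨l, hl⟩ := hg x (f x w)
    exact (hcompat x hl hk).1.2 rfl
  · intro v
    obtain ⟨l, hl⟩ := hg x v
    exact (hfiff x _ _).2 ⟨l, hl⟩
  · intro a b
    obtain ⟨k, hk⟩ := hf x a
    obtain ⟨l, hl⟩ := hf x b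
    exact (hcompat x hk hl).2.symm
  · intro x a ha
    exact (hfiff x _ _).2 ⟨0, ha⟩
  · intro w v
    have : {x | f x w = v} = ⋃ k, q k ⁻¹' {r | (w, v) ∈ r} := by
      ext x
      simp [hfiff]
    change MeasurableSet {x | f x w = v}
    rw [this]
    exact MeasurableSet.iUnion fun k => hqm k trivial

/-! ### Generic graphs and the extension property -/

theorem IsGenericKFree.cliqueFree {V : Type*} {n : ℕ} {Γ : SimpleGraph V}
    (h : IsGenericKFree n Γ) : Γ.CliqueFree n := by
  by_contra hc
  have := (h.age _ _).1 ⟨SimpleGraph.topEmbeddingOfNotCliqueFree hc⟩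
  exact SimpleGraph.IsContained.not_cliqueFree (SimpleGraph.IsContained.refl _) this

theorem IsGenericKFree.nonempty_embedding {V U : Type*} [Fintype U] {n : ℕ} {Γ : SimpleGraph V}
    (h : IsGenericKFree n Γ) {H : SimpleGraph U} (hH : H.CliqueFree n) : Nonempty (H ↪g Γ) := by
  let e := Fintype.equivFin U
  let i : H.map e.toEmbedding ≃g H := (SimpleGraph.Iso.map e H).symm
  obtain ⟨f⟩ := (h.age _ (H.map e.toEmbedding)).2 (hH.comap i.toCopy.isContained)
  exact ⟨f.comp i.symm.toEmbedding⟩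

/-- The induced graph on `S` together with a new vertex whose set of neighbours is `A`. -/
def SimpleGraph.adjoin {V : Type*} (Γ : SimpleGraph V) (S A : Finset V) :
    SimpleGraph (Option S) where
  Adj
    | some a, some b => Γ.Adj a b
    | some a, none => a.1 ∈ A
    | none, some a => a.1 ∈ A
    | none, none => False
  symm := ⟨by
    rintro (_ | a) (_ | b) h
    · exact h
    · exact h
    · exact h
    · exact SimpleGraph.Adj.symm (G := Γ) h⟩
  loopless := ⟨by
    rintro (_ | a) h
    · exact h
    · exact Γ.ne_of_adj h rfl⟩

/-- A $K_n$ through the new vertex leaves an $(n-1)$-clique inside `A`; any other lies in `Γ`. -/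
theorem SimpleGraph.CliqueFree.adjoin {V : Type*} {n : ℕ} {Γ : SimpleGraph V}
    (hΓ : Γ.CliqueFree n) {S A : Finset V} (hA : ∀ s ⊆ A, ¬ Γ.IsNClique (n - 1) s) :
    (Γ.adjoin S A).CliqueFree n := by
  classical
  intro s hs
  let t := s.eraseNone.map (Function.Embedding.subtype (· ∈ S))
  have ht : Γ.IsClique t := by
    rw [SimpleGraph.isClique_iff]
    intro a ha b hb hab
    simp only [t, Finset.coe_map, Set.mem_image, Finset.mem_coe, Finset.mem_eraseNone] at ha hb
    obtain ⟨a, ha, rfl⟩ := ha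
    obtain ⟨b, hb, rfl⟩ := hb
    exact hs.1 ha hb fun h => hab (congrArg _ (Option.some.inj h))
  have hcard : t.card = (s.erase none).card := by
    rw [← Finset.map_some_eraseNone, Finset.card_map, Finset.card_map]
  by_cases hnone : none ∈ s
  · refine hA t ?_ ⟨ht, by rw [hcard, Finset.card_erase_of_mem hnone, hs.2]⟩
    intro a ha
    simp only [t, Finset.mem_map, Finset.mem_eraseNone] at ha
    obtain ⟨a, ha, rfl⟩ := ha
    exact hs.1 hnone ha (by simp)
  · exact hΓ t ⟨ht, by rw [hcard, Finset.erase_eq_of_notMem hnone, hs.2]⟩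

/-- The age provides a copy of `A ∪ B` with the desired extra vertex somewhere in `Γ`; homogeneity
gives an automorphism carrying that copy back onto `A ∪ B`, and the extra vertex with it. -/
theorem IsGenericKFree.hasKFreeExtension {V : Type*} {n : ℕ} {Γ : SimpleGraph V}
    (h : IsGenericKFree n Γ) : HasKFreeExtension n Γ := by
  classical
  intro A B hAB hA
  obtain ⟨e⟩ := h.nonempty_embedding (h.cliqueFree.adjoin (S := A ∪ B) hA)
  let j : ↥(A ∪ B) ↪ V := ⟨fun a => e (some a), fun a b hab => Option.some.inj (e.injective hab)⟩
  have hg : ∀ s : ((Finset.univ.map j : Finset V) : Set V), ∃ a, j a = s := fun s => by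
    simpa using s.2
  choose g hg using hg
  let f : Γ.induce ((Finset.univ.map j : Finset V) : Set V) ↪g Γ :=
    ⟨⟨fun s => (g s).1, fun s t hst => Subtype.ext <| by
      rw [← hg s, ← hg t, Subtype.ext hst]⟩, fun {s t} => by
      change Γ.Adj (g s).1 (g t).1 ↔ Γ.Adj s.1 t.1
      rw [← hg s, ← hg t]
      exact (e.map_rel_iff (a := some (g s)) (b := some (g t))).symm⟩
  obtain ⟨φ, hφ⟩ := h.homogeneous _ f
  have hφ' (a : ↥(A ∪ B)) : φ (e (some a)) = a := by
    have := hφ ⟨j a, by simp⟩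
    refine this.trans ?_
    change (g ⟨j a, _⟩).1 = a.1
    exact congrArg _ (j.injective (hg ⟨j a, by simp⟩))
  have hadj (a : ↥(A ∪ B)) : Γ.Adj (φ (e none)) a.1 ↔ a.1 ∈ A := by
    rw [← hφ' a, φ.map_adj_iff, hφ' a]
    exact e.map_rel_iff (a := none) (b := some a)
  refine ⟨φ (e none), fun hB => ?_, fun a ha => ?_, fun b hb => ?_⟩
  · have := hφ' ⟨_, Finset.mem_union_right A hB⟩
    simpa using e.injective (φ.injective this)
  · exact (hadj ⟨a, Finset.mem_union_left B ha⟩).2 ha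
  · exact fun hb' => Finset.disjoint_left.1 hAB
      ((hadj ⟨b, Finset.mem_union_right A hb⟩).1 hb') hb

/-- Only the "forth" half of back-and-forth is needed, one vertex at a time. -/
theorem HasKFreeExtension.nonempty_embedding {V U : Type*} [Fintype U] {n : ℕ} (hn : 1 ≤ n)
    {Γ : SimpleGraph V} (h : HasKFreeExtension n Γ) {H : SimpleGraph U} (hH : H.CliqueFree n) :
    Nonempty (H ↪g Γ) := by
  classical
  have key (s : Finset U) : ∃ p, IsPartialIso H Γ p ∧ ∀ u ∈ s, ∃ v, (u, v) ∈ p := by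
    induction s using Finset.induction_on with
    | empty => exact ⟨∅, fun a ha => by simp at ha, fun u hu => by simp at hu⟩
    | insert u s hu ih =>
      obtain ⟨p, hp, hs⟩ := ih
      obtain ⟨q, hpq, hq, hu⟩ := hp.exists_extend hn hH h u
      refine ⟨q, hq, fun u' hu' => ?_⟩
      rcases Finset.mem_insert.1 hu' with rfl | hu'
      · exact hu
      · obtain ⟨v, hv⟩ := hs u' hu'
        exact ⟨v, hpq hv⟩
  obtain ⟨p, hp, hs⟩ := key Finset.univ
  choose f hf using fun u => hs u (Finset.mem_univ u)
  exact ⟨⟨⟨f, fun a b hab => (hp _ (hf a) _ (hf b)).1.2 hab⟩,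
    fun {a b} => (hp _ (hf a) _ (hf b)).2.symm⟩⟩

/-- Homogeneity is back-and-forth from `Γ` to itself, started at the given finite map; the parameter
space is a point. -/
theorem HasKFreeExtension.isGenericKFree {V : Type*} [Countable V] {n : ℕ} (hn : 2 ≤ n)
    {Γ : SimpleGraph V} (h : HasKFreeExtension n Γ) (hΓ : Γ.CliqueFree n) :
    IsGenericKFree n Γ where
  homogeneous S f := by
    classical
    obtain ⟨θ, hθ, -⟩ := exists_measurable_iso (X := Unit) hn (fun _ => Γ) Γ
      (fun _ _ => MeasurableSet.of_discrete) (fun _ => hΓ) hΓ (fun _ => h) h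
      (Finset.univ.image fun s : S => (s.1, f s)) (by
        intro _ a ha b hb
        simp only [Finset.mem_image, Finset.mem_univ, true_and] at ha hb
        obtain ⟨a, rfl⟩ := ha
        obtain ⟨b, rfl⟩ := hb
        exact ⟨Subtype.ext_iff.symm.trans f.injective.eq_iff.symm,
          (f.map_rel_iff (a := a) (b := b)).symm⟩)
    exact ⟨θ (), fun s => hθ () (s.1, f s) (Finset.mem_image_of_mem _ (Finset.mem_univ _))⟩
  age k H := by
    refine ⟨fun ⟨f⟩ => hΓ.comap f.isContained, fun hH => h.nonempty_embedding (by omega) hH⟩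

/-! ### The tower over a graph -/

/-- Names for the vertices of the generic graph built over a graph with vertex set `α`. A name that
is not of the form `base a` carries a finite list of names, its intended set of neighbours among
the names of smaller size. -/
inductive Tower (α : Type) : Type
  | base (a : α) : Tower α
  | nil (b : Bool) (k : ℕ) : Tower α
  | cons (b : Bool) (h t : Tower α) : Tower α
  deriving Countable

namespace Tower

variable {α β γ : Type}

/-- The list carried by a name. -/
def elems : Tower α → List (Tower α)
  | base _ => []
  | nil _ _ => []
  | cons _ h t => h :: t.elems

/-- The size of a name; it is zero exactly for the names `base a`. -/
def size : Tower α → ℕ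
  | base _ => 0
  | nil _ _ => 1
  | cons _ h t => h.size + t.size + 1

theorem size_lt_of_mem_elems {x v : Tower α} (h : x ∈ v.elems) : x.size < v.size := by
  induction v with
  | base a => simp [elems] at h
  | nil b k => simp [elems] at h
  | cons b y t _ ih =>
    simp only [elems, List.mem_cons] at h
    rcases h with rfl | h
    · simp only [size]
      omega
    · have := ih h
      simp only [size]
      omega

/-- Adjacency of base names. -/
def BaseAdj (G : SimpleGraph α) (u v : Tower α) : Prop :=
  ∃ a b, u = base a ∧ v = base b ∧ G.Adj a b

/-- A name is good if its list contains no clique of size `m`. -/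
def IsGood (m : ℕ) (G : SimpleGraph α) (v : Tower α) : Prop :=
  ¬ ∃ s : Finset (Tower α), s.card = m ∧ (∀ x ∈ s, x ∈ v.elems) ∧
    -- The memberships are repeated so that the termination proof can see that `x` and `y` are
    -- smaller than `v`; the last disjunction is adjacency in the graph under construction.
    ∀ x ∈ s, ∀ y ∈ s, x ≠ y → ∃ (_ : x ∈ v.elems) (_ : y ∈ v.elems),
      BaseAdj G x y ∨ (x ∈ y.elems ∧ IsGood m G y) ∨ (y ∈ x.elems ∧ IsGood m G x)
termination_by v.size
decreasing_by
  all_goals exact size_lt_of_mem_elems (by assumption)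

/-- The graph in which every good name is joined to the members of its list. -/
def graph (n : ℕ) (G : SimpleGraph α) : SimpleGraph (Tower α) where
  Adj u v := BaseAdj G u v ∨ (u ∈ v.elems ∧ IsGood (n - 1) G v) ∨
    (v ∈ u.elems ∧ IsGood (n - 1) G u)
  symm := ⟨by
    rintro u v (⟨a, b, rfl, rfl, h⟩ | h | h)
    · exact Or.inl ⟨b, a, rfl, rfl, h.symm⟩
    · exact Or.inr (Or.inr h)
    · exact Or.inr (Or.inl h)⟩
  loopless := ⟨by
    rintro u (⟨a, b, rfl, h, h'⟩ | h | h)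
    · cases h
      exact G.ne_of_adj h' rfl
    · exact (size_lt_of_mem_elems h.1).ne rfl
    · exact (size_lt_of_mem_elems h.1).ne rfl⟩

theorem graph_adj {n : ℕ} {G : SimpleGraph α} {u v : Tower α} : (graph n G).Adj u v ↔
    BaseAdj G u v ∨ (u ∈ v.elems ∧ IsGood (n - 1) G v) ∨ (v ∈ u.elems ∧ IsGood (n - 1) G u) :=
  Iff.rfl

theorem isGood_iff {n : ℕ} {G : SimpleGraph α} {v : Tower α} : IsGood (n - 1) G v ↔
    ∀ s : Finset (Tower α), (∀ x ∈ s, x ∈ v.elems) → ¬ (graph n G).IsNClique (n - 1) s := by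
  rw [IsGood]
  push Not
  refine forall_congr' fun s => ?_
  constructor
  · intro h hs hc
    obtain ⟨x, hx, y, hy, hxy, h⟩ := h hc.2 hs
    have := hc.1 hx hy hxy
    obtain ⟨h1, h2, h3⟩ := h (hs x hx) (hs y hy)
    rcases this with h | h | h
    · exact h1 h
    · exact h2 h.1 h.2
    · exact h3 h.1 h.2
  · intro h hc hs
    by_contra hcon
    push Not at hcon
    refine h hs ⟨fun x hx y hy hxy => ?_, hc⟩
    obtain ⟨-, -, h⟩ := hcon x hx y hy hxy
    rw [graph_adj]
    by_contra hno
    push Not at hno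
    exact hno.2.2 (h hno.1 hno.2.1).1 (h hno.1 hno.2.1).2

theorem graph_adj_base {n : ℕ} {G : SimpleGraph α} {a b : α} :
    (graph n G).Adj (base a) (base b) ↔ G.Adj a b := by
  simp [graph_adj, BaseAdj, elems]

/-- Consider a vertex `v` of largest size in a $K_n$. If its size is zero, the clique lies in the
base graph. Otherwise every edge from `v` to the rest of the clique comes from the list of `v`, so
this list contains an $(n-1)$-clique although `v` is good. -/
theorem cliqueFree_graph {n : ℕ} (hn : 2 ≤ n) {G : SimpleGraph α} (hG : G.CliqueFree n) :
    (graph n G).CliqueFree n := by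
  classical
  intro s hs
  obtain ⟨v, hv, hmax⟩ := s.exists_max_image size (Finset.card_pos.1 (by rw [hs.2]; omega))
  by_cases h0 : v.size = 0
  · have hb (x : s) : ∃ a, x.1 = base a := by
      have := hmax _ x.2
      obtain ⟨x, hx⟩ := x
      cases x with
      | base a => exact ⟨a, rfl⟩
      | nil b k => simp only [size] at this; omega
      | cons b h t => simp only [size] at this; omega
    choose g hg using hb
    have hinj : Function.Injective g := fun a b hab =>
      Subtype.ext (by rw [hg a, hg b, hab])
    refine hG (Finset.univ.image g) ⟨?_, by
      rw [Finset.card_image_of_injective _ hinj, Finset.card_univ, Fintype.card_coe, hs.2]⟩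
    rw [SimpleGraph.isClique_iff]
    intro a ha b hb hab
    simp only [Finset.coe_image, Finset.coe_univ, Set.image_univ, Set.mem_range] at ha hb
    obtain ⟨a, rfl⟩ := ha
    obtain ⟨b, rfl⟩ := hb
    rw [← graph_adj_base (n := n), ← hg, ← hg]
    exact hs.1 a.2 b.2 fun h => hab (congrArg g (Subtype.ext h))
  · have key : ∀ x ∈ s.erase v, x ∈ v.elems ∧ IsGood (n - 1) G v := by
      intro x hx
      have hxs := Finset.mem_of_mem_erase hx
      rcases hs.1 hxs hv (Finset.ne_of_mem_erase hx) with ⟨a, b, -, rfl, -⟩ | h | h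
      · exact (h0 rfl).elim
      · exact h
      · exact absurd (hmax x hxs) (size_lt_of_mem_elems h.1).not_ge
    have hcard : (s.erase v).card = n - 1 := by rw [Finset.card_erase_of_mem hv, hs.2]
    -- Since $n\ge 2$ the clique has a further vertex, and the edge to it shows that `v` is good.
    obtain ⟨x, hx⟩ := (Finset.card_pos (s := s.erase v)).1 (by omega)
    exact isGood_iff.1 (key x hx).2 _ (fun y hy => (key y hy).1)
      ⟨hs.1.subset (by simp), hcard⟩

theorem hasKFreeExtension_graph (n : ℕ) (G : SimpleGraph α) :
    HasKFreeExtension n (graph n G) := by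
  classical
  intro A B hAB hA
  let f (k : ℕ) (l : List (Tower α)) : Tower α := l.foldr (cons true) (nil true k)
  have hf (k : ℕ) (l : List (Tower α)) : (f k l).elems = l := by
    induction l with
    | nil => rfl
    | cons x l ih => exact congrArg (x :: ·) ih
  have hinj (l : List (Tower α)) : Function.Injective fun k => f k l := by
    intro i j h
    induction l with
    | nil => exact (nil.inj h).2
    | cons x l ih => exact ih (cons.inj h).2.2
  -- Infinitely many names carry the list `A`, so one of them avoids both `B` and the lists of the
  -- members of `B`; its edges to `B` could then come only from its own list.
  obtain ⟨v, ⟨k, rfl⟩, hv⟩ := (Set.infinite_range_of_injective (hinj A.toList)).exists_notMem_finset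
    (B ∪ B.biUnion fun b => b.elems.toFinset)
  simp only [Finset.mem_union, Finset.mem_biUnion, List.mem_toFinset, not_or, not_exists,
    not_and] at hv
  have hgood : IsGood (n - 1) G (f k A.toList) := isGood_iff.2 fun s hs => hA s fun x hx => by
    simpa [hf] using hs x hx
  have hbase (b : Tower α) : ¬ BaseAdj G (f k A.toList) b := by
    rintro ⟨a, -, h, -⟩
    revert h
    cases A.toList <;> simp [f]
  refine ⟨f k A.toList, hv.1, fun a ha => ?_, fun b hb => ?_⟩
  · exact Or.inr (Or.inr ⟨by simpa [hf] using ha, hgood⟩)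
  · rintro (h | h | h)
    · exact hbase b h
    · exact hv.2 b hb h.1
    · have h := h.1
      rw [hf, Finset.mem_toList] at h
      exact Finset.disjoint_left.1 hAB h hb

/-! ### Functoriality -/

/-- Goodness of a name depends only on base adjacency and on the lists of smaller names, whence the
induction on size. -/
theorem isGood_apply {n : ℕ} {G : SimpleGraph α} {H : SimpleGraph β} (e : Tower α ≃ Tower β)
    (he : ∀ v, (e v).elems = v.elems.map e)
    (hb : ∀ u v, BaseAdj H (e u) (e v) ↔ BaseAdj G u v) (v : Tower α) :
    IsGood (n - 1) H (e v) ↔ IsGood (n - 1) G v := by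
  induction hk : v.size using Nat.strong_induction_on generalizing v with
  | _ k ih =>
    subst hk
    have hmem (u v : Tower α) : e u ∈ (e v).elems ↔ u ∈ v.elems := by
      rw [he, List.mem_map_of_injective e.injective]
    rw [isGood_iff, isGood_iff, ← (Equiv.finsetCongr e).forall_congr_right]
    refine forall_congr' fun s => ?_
    have h1 : (∀ x ∈ Equiv.finsetCongr e s, x ∈ (e v).elems) ↔ ∀ x ∈ s, x ∈ v.elems := by
      rw [← e.forall_congr_right]
      simp [hmem]
    rw [h1]
    refine imp_congr_right fun hs => not_congr ?_
    rw [SimpleGraph.isNClique_iff, SimpleGraph.isNClique_iff]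
    refine and_congr ?_ (by simp)
    simp only [SimpleGraph.isClique_iff, Set.Pairwise, Finset.mem_coe]
    simp only [Equiv.finsetCongr_apply, Finset.mem_map_equiv, ← e.forall_congr_right (q := fun x =>
      e.symm x ∈ s → _), Equiv.symm_apply_apply]
    refine forall₂_congr fun x hx => forall₂_congr fun y hy => ?_
    refine imp_congr (by simp) ?_
    rw [graph_adj, graph_adj, hb, hmem, hmem, ih _ (size_lt_of_mem_elems (hs x hx)) x rfl,
      ih _ (size_lt_of_mem_elems (hs y hy)) y rfl]

/-- An equivalence of names that respects lists and base adjacency is an isomorphism. -/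
def graphIso (n : ℕ) {G : SimpleGraph α} {H : SimpleGraph β} (e : Tower α ≃ Tower β)
    (he : ∀ v, (e v).elems = v.elems.map e)
    (hb : ∀ u v, BaseAdj H (e u) (e v) ↔ BaseAdj G u v) : graph n G ≃g graph n H where
  toEquiv := e
  map_rel_iff' {u v} := by
    rw [graph_adj, graph_adj, hb, isGood_apply e he hb, isGood_apply e he hb, he, he,
      List.mem_map_of_injective e.injective, List.mem_map_of_injective e.injective]

/-- The action on names of a map of base vertices and a map of flags. -/
def map (σ : α → β) (c : Bool → Bool) : Tower α → Tower β
  | base a => base (σ a)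
  | nil b k => nil (c b) k
  | cons b h t => cons (c b) (h.map σ c) (t.map σ c)

theorem map_map (σ : α → β) (τ : β → γ) (c d : Bool → Bool) (v : Tower α) :
    (v.map σ c).map τ d = v.map (τ ∘ σ) (d ∘ c) := by
  induction v <;> simp_all [map]

theorem map_id (v : Tower α) : v.map id id = v := by
  induction v <;> simp_all [map]

theorem elems_map (σ : α → β) (c : Bool → Bool) (v : Tower α) :
    (v.map σ c).elems = v.elems.map (map σ c) := by
  induction v <;> simp_all [map, elems]

/-- The equivalence of names induced by equivalences of base vertices and of flags. -/
def mapEquiv (σ : α ≃ β) (c : Bool ≃ Bool) : Tower α ≃ Tower β where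
  toFun := map σ c
  invFun := map σ.symm c.symm
  left_inv v := by simp [map_map, map_id]
  right_inv v := by simp [map_map, map_id]

/-- The isomorphism of graphs of names induced by an isomorphism of the base graphs and an
equivalence of flags. -/
def mapIso (n : ℕ) {G : SimpleGraph α} {H : SimpleGraph β} (σ : G ≃g H) (c : Bool ≃ Bool) :
    graph n G ≃g graph n H :=
  graphIso n (mapEquiv σ.toEquiv c) (elems_map σ c) (by
    intro u v
    constructor
    · rintro ⟨a, b, ha, hb, h⟩
      cases u <;> cases v <;> simp [mapEquiv, map] at ha hb
      subst ha hb
      exact ⟨_, _, rfl, rfl, σ.map_adj_iff.1 h⟩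
    · rintro ⟨a, b, rfl, rfl, h⟩
      exact ⟨_, _, rfl, rfl, σ.map_adj_iff.2 h⟩)

theorem mapIso_apply (n : ℕ) {G : SimpleGraph α} {H : SimpleGraph β} (σ : G ≃g H)
    (c : Bool ≃ Bool) (v : Tower α) : mapIso n σ c v = v.map σ c := rfl

/-- The automorphism of the graph of names that negates all flags. -/
def flip (n : ℕ) (G : SimpleGraph α) : graph n G ≃g graph n G :=
  mapIso n SimpleGraph.Iso.refl Equiv.boolNot

theorem flip_apply (n : ℕ) (G : SimpleGraph α) (v : Tower α) : flip n G v = v.map id not := rfl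

/-- Every name outside the base has a flag at its root, which negation changes. -/
theorem map_id_not_eq_iff {v : Tower α} : v.map id not = v ↔ ∃ a, v = base a := by
  cases v <;> simp [map]

/-! ### Measurability -/

section Measurability

variable [Countable α] {X : Type*} [MeasurableSpace X] {G : X → SimpleGraph α}

theorem measurable_baseAdj (hG : ∀ a b, Measurable fun x => (G x).Adj a b) (u v : Tower α) :
    Measurable fun x => BaseAdj (G x) u v :=
  Measurable.exists fun a => Measurable.exists fun b =>
    measurable_const.and (measurable_const.and (hG a b))

theorem measurable_isGood (n : ℕ) (hG : ∀ a b, Measurable fun x => (G x).Adj a b) (v : Tower α) :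
    Measurable fun x => IsGood (n - 1) (G x) v := by
  induction hk : v.size using Nat.strong_induction_on generalizing v with
  | _ k ih =>
    subst hk
    simp only [isGood_iff]
    refine Measurable.forall fun s => ?_
    simp only [SimpleGraph.isNClique_iff, SimpleGraph.isClique_iff, Set.Pairwise, Finset.mem_coe]
    simp only [graph_adj]
    -- The induction hypothesis covers only members of the list of `v`; for other `s` the condition
    -- is vacuous.
    by_cases hs : ∀ x ∈ s, x ∈ v.elems
    · refine measurable_const.imp (Measurable.not (Measurable.and ?_ measurable_const))
      refine Measurable.forall fun a => ?_
      by_cases ha : a ∈ s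
      · refine measurable_const.imp (Measurable.forall fun b => ?_)
        by_cases hb : b ∈ s
        · refine measurable_const.imp (measurable_const.imp ((measurable_baseAdj hG a b).or
            (Measurable.or (measurable_const.and ?_) (measurable_const.and ?_))))
          · exact ih _ (size_lt_of_mem_elems (hs b hb)) b rfl
          · exact ih _ (size_lt_of_mem_elems (hs a ha)) a rfl
        · simp only [hb, false_imp_iff]
          exact measurable_const
      · simp only [ha, false_imp_iff]
        exact measurable_const
    · simp only [hs, false_imp_iff]
      exact measurable_const

theorem measurable_graph_adj (n : ℕ) (hG : ∀ a b, Measurable fun x => (G x).Adj a b)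
    (u v : Tower α) : Measurable fun x => (graph n (G x)).Adj u v :=
  (measurable_baseAdj hG u v).or ((measurable_const.and (measurable_isGood n hG v)).or
    (measurable_const.and (measurable_isGood n hG u)))

end Measurability

end Tower

/-! ### Reducing isomorphism to conjugacy -/

theorem HasKFreeExtension.map {V W : Type*} {n : ℕ} {Γ : SimpleGraph V}
    (h : HasKFreeExtension n Γ) (e : V ≃ W) : HasKFreeExtension n (Γ.map e.toEmbedding) := by
  intro A B hAB hA
  obtain ⟨v, hv, hvA, hvB⟩ := h (A.map e.symm.toEmbedding) (B.map e.symm.toEmbedding)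
    ((Finset.disjoint_map _).2 hAB) (fun s hs hc => hA (s.map e.toEmbedding) (fun x hx => by
      simpa using hs (Finset.mem_map_equiv.1 hx)) hc.map)
  have hadj (x : W) : (Γ.map e.toEmbedding).Adj (e v) x ↔ Γ.Adj v (e.symm x) := by
    conv_lhs => rw [← e.apply_symm_apply x]
    exact SimpleGraph.map_adj_apply
  refine ⟨e v, fun hB => hv (by simpa using hB), fun a ha => (hadj a).2 (hvA _ (by simpa using ha)),
    fun b hb hb' => hvB _ (by simpa using hb) ((hadj b).1 hb')⟩

theorem exists_isGenericKFree {n : ℕ} (hn : 2 ≤ n) : ∃ Γ : SimpleGraph ℕ, IsGenericKFree n Γ := by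
  have : Infinite (Tower ℕ) := Infinite.of_injective Tower.base fun a b h => Tower.base.inj h
  obtain ⟨_⟩ := nonempty_denumerable (Tower ℕ)
  let e : Tower ℕ ≃ ℕ := Denumerable.eqv _
  let Γ := Tower.graph n (⊥ : SimpleGraph ℕ)
  have hbot : (⊥ : SimpleGraph ℕ).CliqueFree n := SimpleGraph.cliqueFree_bot hn
  have hΓ : IsGenericKFree n Γ :=
    (Tower.hasKFreeExtension_graph n _).isGenericKFree hn (Tower.cliqueFree_graph hn hbot)
  let i : Γ ≃g Γ.map e.toEmbedding := SimpleGraph.Iso.map e Γ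
  have hext : HasKFreeExtension n (Γ.map e.toEmbedding) :=
    (Tower.hasKFreeExtension_graph n _).map e
  exact ⟨_, hext.isGenericKFree hn (hΓ.cliqueFree.comap i.symm.toCopy.isContained)⟩

theorem kFreeIso_borelReducible_autConj {n : ℕ} (hn : 2 ≤ n) {V : Type*} [Countable V]
    {Γ : SimpleGraph V} (h : IsGenericKFree n Γ) : BorelReducible (kFreeIso n) (autConj Γ) := by
  have hm (a b : ℕ) : Measurable fun G : KFreeGraph n => G.1.Adj a b :=
    (SimpleGraph.measurable_iff_adj.1 measurable_id a b).comp measurable_subtype_coe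
  obtain ⟨θ, -, hθ⟩ := exists_measurable_iso hn (fun G : KFreeGraph n => Tower.graph n G.1) Γ
    (fun a b => measurableSet_setOfPred.2 (Tower.measurable_graph_adj n hm a b))
    (fun G => Tower.cliqueFree_graph hn G.2) h.cliqueFree
    (fun G => Tower.hasKFreeExtension_graph n G.1) h.hasKFreeExtension ∅
    (fun _ a ha => by simp at ha)
  refine ⟨fun G => (θ G).symm.trans ((Tower.flip n G.1).trans (θ G)), ?_, fun G H => ⟨?_, ?_⟩⟩
  · let : MeasurableSpace V := ⊤
    have : DiscreteMeasurableSpace V := ⟨fun _ => trivial⟩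
    rw [measurable_comap_iff, measurable_pi_iff]
    intro v
    refine measurable_to_countable' fun v' => ?_
    -- Quantifying over the preimage `w` of `v` eliminates the inverse of `θ G`, leaving only events
    -- known to be measurable.
    have : (fun G : KFreeGraph n => θ G (Tower.flip n G.1 ((θ G).symm v))) ⁻¹' {v'} =
        ⋃ w : Tower ℕ, {G | θ G w = v} ∩ {G | θ G (w.map id not) = v'} := by
      ext G
      simp only [Set.mem_preimage, Set.mem_singleton_iff, Set.mem_iUnion, Set.mem_inter_iff,
        Set.mem_ofPred_eq, Tower.flip_apply]
      constructor
      · intro h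
        exact ⟨(θ G).symm v, by simp, h⟩
      · rintro ⟨w, rfl, h⟩
        simpa using h
    change MeasurableSet ((fun G : KFreeGraph n => θ G (Tower.flip n G.1 ((θ G).symm v))) ⁻¹' {v'})
    rw [this]
    exact MeasurableSet.iUnion fun w => (hθ _ _).inter (hθ _ _)
  · rintro ⟨σ⟩
    -- The lift of `σ` leaves flags unchanged, so it commutes with negating them.
    refine isConj_iff.2 ⟨(θ G).symm.trans ((Tower.mapIso n σ (Equiv.refl _)).trans (θ H)), ?_⟩
    rw [mul_inv_eq_iff_eq_mul]
    ext v
    simp only [RelIso.mul_apply, RelIso.trans_apply, RelIso.symm_apply_apply, Tower.flip_apply,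
      Tower.mapIso_apply, Tower.map_map]
    rfl
  · intro hc
    obtain ⟨ψ, hψ⟩ := isConj_iff.1 hc
    rw [mul_inv_eq_iff_eq_mul] at hψ
    -- Read between the towers, the conjugating element intertwines the two flips, so it matches
    -- their fixed points, which are the base vertices.
    let χ : Tower.graph n G.1 ≃g Tower.graph n H.1 := (θ G).trans (ψ.trans (θ H).symm)
    have hχ (v : Tower ℕ) : χ (v.map id not) = (χ v).map id not := by
      have := congrArg (θ H).symm (RelIso.ext_iff.1 hψ (θ G v))
      simp only [RelIso.mul_apply, RelIso.trans_apply, RelIso.symm_apply_apply,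
        Tower.flip_apply] at this
      exact this
    have hfix (v : Tower ℕ) : (∃ a, v = Tower.base a) ↔ ∃ a, χ v = Tower.base a := by
      rw [← Tower.map_id_not_eq_iff, ← Tower.map_id_not_eq_iff, ← hχ, χ.injective.eq_iff]
    choose f hf using fun a => (hfix (Tower.base a)).1 ⟨a, rfl⟩
    have hfinj : Function.Injective f := fun a b hab =>
      Tower.base.inj (χ.injective (by rw [hf, hf, hab]))
    have hfsurj : Function.Surjective f := by
      intro b
      obtain ⟨a, ha⟩ := (hfix (χ.symm (Tower.base b))).2 ⟨b, χ.apply_symm_apply _⟩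
      refine ⟨a, Tower.base.inj ?_⟩
      rw [← hf, ← ha, χ.apply_symm_apply]
    refine ⟨⟨Equiv.ofBijective f ⟨hfinj, hfsurj⟩, fun {a b} => ?_⟩⟩
    change H.1.Adj (f a) (f b) ↔ G.1.Adj a b
    rw [← Tower.graph_adj_base (n := n), ← hf, ← hf, χ.map_adj_iff, Tower.graph_adj_base]

/-! ### Coding vertex colours -/

/-- The vertices of the graph coding a coloured graph: the given vertices, a hub for every natural
number `m`, and `m + 2` leaves at the hub `m`. -/
inductive HubVertex (W : Type) : Type
  | vertex (w : W) : HubVertex W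
  | hub (m : ℕ) : HubVertex W
  | leaf (m : ℕ) (i : Fin (m + 2)) : HubVertex W
  deriving Countable

namespace HubVertex

variable {W W' : Type}

/-- Adjacency in the graph coding the graph `G` with vertex colouring `c`: a vertex of colour `k` is
joined to the hubs `2 * k` and `2 * k + 1`, and every hub to its leaves. -/
def Adj (c : W → ℕ) (G : SimpleGraph W) : HubVertex W → HubVertex W → Prop
  | vertex u, vertex v => G.Adj u v
  | vertex u, hub m => m / 2 = c u
  | hub m, vertex u => m / 2 = c u
  | hub m, leaf m' _ => m = m'
  | leaf m' _, hub m => m = m'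
  | _, _ => False

/-- The graph coding the graph `G` with vertex colouring `c`. -/
def graph (c : W → ℕ) (G : SimpleGraph W) : SimpleGraph (HubVertex W) where
  Adj := Adj c G
  symm := ⟨by
    rintro (u | m | ⟨m, i⟩) (v | k | ⟨k, j⟩) h <;> first | exact h | exact G.symm.symm _ _ h⟩
  loopless := ⟨by
    rintro (u | m | ⟨m, i⟩) h <;> simp [Adj] at h⟩

/-- A leaf has one neighbour and hubs are pairwise non-adjacent, so a triangle outside `G` would
join a hub to two adjacent vertices, which would then have the same colour. -/
theorem graph_cliqueFree {c : W → ℕ} {G : SimpleGraph W} (hG : G.CliqueFree 3)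
    (hc : ∀ u v, G.Adj u v → c u ≠ c v) : (graph c G).CliqueFree 3 := by
  classical
  intro s hs
  obtain ⟨x, y, z, hxy, hxz, hyz, -⟩ := SimpleGraph.is3Clique_iff.1 hs
  change Adj c G x y at hxy
  change Adj c G x z at hxz
  change Adj c G y z at hyz
  rcases x with u | m | ⟨m, i⟩ <;> rcases y with v | k | ⟨k, j⟩ <;>
    rcases z with w | l | ⟨l, r⟩ <;> simp only [Adj] at hxy hxz hyz
  · exact hG _ (SimpleGraph.is3Clique_iff.2 ⟨u, v, w, hxy, hxz, hyz, rfl⟩)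
  · exact hc _ _ hxy (hxz.symm.trans hyz)
  · exact hc _ _ hxz (hxy.symm.trans hyz)
  · exact hc _ _ hyz (hxy.symm.trans hxz)

/-- A vertex with exactly one neighbour. -/
def IsLeaf {U : Type*} (K : SimpleGraph U) (x : U) : Prop := ∃ y, ∀ z, K.Adj x z ↔ z = y

theorem isLeaf_apply {U U' : Type*} {K : SimpleGraph U} {K' : SimpleGraph U'} (e : K ≃g K')
    (x : U) : IsLeaf K' (e x) ↔ IsLeaf K x := by
  unfold IsLeaf
  rw [← e.toEquiv.exists_congr_right]
  refine exists_congr fun y => ?_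
  rw [← e.toEquiv.forall_congr_right]
  refine forall_congr' fun z => ?_
  exact iff_congr e.map_adj_iff e.injective.eq_iff

/-- This is why each colour has two hubs and each hub at least two leaves: no other vertex can have
degree one. -/
theorem isLeaf_graph_iff {c : W → ℕ} {G : SimpleGraph W} {x : HubVertex W} :
    IsLeaf (graph c G) x ↔ ∃ m i, x = leaf m i := by
  constructor
  · rintro ⟨y, hy⟩
    rcases x with u | m | ⟨m, i⟩
    · have h1 := (hy (hub (2 * c u))).1 (show 2 * c u / 2 = c u by omega)
      have h2 := (hy (hub (2 * c u + 1))).1 (show (2 * c u + 1) / 2 = c u by omega)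
      have := hub.inj (h1.trans h2.symm)
      omega
    · have h1 := (hy (leaf m 0)).1 rfl
      have h2 := (hy (leaf m 1)).1 rfl
      have := h1.trans h2.symm
      simp at this
    · exact ⟨m, i, rfl⟩
  · rintro ⟨m, i, rfl⟩
    refine ⟨hub m, fun z => ?_⟩
    rcases z with u | k | ⟨k, j⟩
    · exact iff_of_false id (by simp)
    · exact hub.injEq k m ▸ Iff.rfl
    · exact iff_of_false id (by simp)

/-- The number of leaves at a vertex. -/
noncomputable def leafCount {U : Type*} (K : SimpleGraph U) (x : U) : ℕ :=
  {y | K.Adj x y ∧ IsLeaf K y}.ncard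

theorem leafCount_apply {U U' : Type*} {K : SimpleGraph U} {K' : SimpleGraph U'} (e : K ≃g K')
    (x : U) : leafCount K' (e x) = leafCount K x := by
  unfold leafCount
  rw [← Set.ncard_image_of_injective _ e.injective]
  congr 1
  ext y
  obtain ⟨y, rfl⟩ := e.surjective y
  simp [isLeaf_apply, e.map_adj_iff]

theorem leafCount_hub (c : W → ℕ) (G : SimpleGraph W) (m : ℕ) :
    leafCount (graph c G) (hub m) = m + 2 := by
  have : {y | (graph c G).Adj (hub m) y ∧ IsLeaf (graph c G) y} = Set.range (leaf m) := by
    ext y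
    simp only [Set.mem_ofPred_eq, isLeaf_graph_iff, Set.mem_range]
    constructor
    · rintro ⟨h, k, i, rfl⟩
      obtain rfl : m = k := h
      exact ⟨i, rfl⟩
    · rintro ⟨i, rfl⟩
      exact ⟨rfl, m, i, rfl⟩
  rw [leafCount, this, ← Set.image_univ, Set.ncard_image_of_injective _ fun i j h => by
    simpa using h, Set.ncard_univ, Nat.card_fin]

theorem leafCount_of_ne_hub {c : W → ℕ} {G : SimpleGraph W} {x : HubVertex W}
    (hx : ∀ m, x ≠ hub m) : leafCount (graph c G) x = 0 := by
  have : {y | (graph c G).Adj x y ∧ IsLeaf (graph c G) y} = ∅ := by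
    rw [Set.eq_empty_iff_forall_notMem]
    rintro y ⟨h, hy⟩
    obtain ⟨m, i, rfl⟩ := isLeaf_graph_iff.1 hy
    rcases x with u | k | ⟨k, j⟩
    · exact h
    · exact hx k rfl
    · exact h
  rw [leafCount, this, Set.ncard_empty]

section Iso

variable {c : W → ℕ} {G : SimpleGraph W} {c' : W' → ℕ} {H : SimpleGraph W'}

/-- Leaf counts are invariant; they are distinct and positive on hubs and zero elsewhere. -/
theorem iso_hub (e : graph c G ≃g graph c' H) (m : ℕ) : e (hub m) = hub m := by
  have h : leafCount (graph c' H) (e (hub m)) = m + 2 := by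
    rw [leafCount_apply, leafCount_hub]
  by_cases hx : ∀ k, e (hub m) ≠ hub k
  · rw [leafCount_of_ne_hub hx] at h
    omega
  · push Not at hx
    obtain ⟨k, hk⟩ := hx
    rw [hk, leafCount_hub] at h
    rw [hk, show k = m by omega]

theorem exists_iso_vertex (e : graph c G ≃g graph c' H) (u : W) :
    ∃ v, e (vertex u) = vertex v := by
  rcases h : e (vertex u) with v | m | ⟨m, i⟩
  · exact ⟨v, rfl⟩
  · rw [← iso_hub e m] at h
    simpa using e.injective h
  · have := (isLeaf_apply e (vertex u)).1 (isLeaf_graph_iff.2 ⟨m, i, h⟩)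
    simp [isLeaf_graph_iff] at this

/-- The map of coding vertices induced by a map of vertices. -/
def map (f : W → W') : HubVertex W → HubVertex W'
  | vertex u => vertex (f u)
  | hub m => hub m
  | leaf m i => leaf m i

/-- The coding graphs are isomorphic exactly if the coloured graphs are. -/
theorem nonempty_graph_iso_iff : Nonempty (graph c G ≃g graph c' H) ↔
    ∃ f : G ≃g H, ∀ u, c' (f u) = c u := by
  constructor
  · rintro ⟨e⟩
    choose f hf using exists_iso_vertex e
    choose g hg using exists_iso_vertex e.symm
    refine ⟨⟨⟨f, g, fun u => ?_, fun v => ?_⟩, fun {u v} => ?_⟩, fun u => ?_⟩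
    · apply vertex.inj
      rw [← hg, ← hf, e.symm_apply_apply]
    · apply vertex.inj
      rw [← hf, ← hg, e.apply_symm_apply]
    · change (graph c' H).Adj (vertex (f u)) (vertex (f v)) ↔ (graph c G).Adj (vertex u) (vertex v)
      rw [← hf, ← hf, e.map_adj_iff]
    -- Hubs are fixed, so the colour of `u` can be read off from its hub `2 * c u`.
    · have : (graph c' H).Adj (e (vertex u)) (e (hub (2 * c u))) :=
        e.map_adj_iff.2 (show 2 * c u / 2 = c u by omega)
      rw [hf, iso_hub] at this
      have : 2 * c u / 2 = c' (f u) := this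
      change c' (f u) = c u
      omega
  · rintro ⟨f, hf⟩
    refine ⟨⟨⟨map f, map f.symm, ?_, ?_⟩, ?_⟩⟩
    · rintro (u | m | ⟨m, i⟩) <;> simp [map]
    · rintro (u | m | ⟨m, i⟩) <;> simp [map]
    · rintro (u | m | ⟨m, i⟩) (v | k | ⟨k, j⟩) <;> simp [map, graph, Adj, hf, f.map_adj_iff]

end Iso

theorem measurable_graph_adj {X : Type*} [MeasurableSpace X] {c : W → ℕ} {G : X → SimpleGraph W}
    (hG : ∀ a b, Measurable fun x => (G x).Adj a b) (u v : HubVertex W) :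
    Measurable fun x => (graph c (G x)).Adj u v := by
  rcases u with u | m | ⟨m, i⟩ <;> rcases v with v | k | ⟨k, j⟩ <;>
    first | exact hG u v | exact measurable_const

end HubVertex

/-! ### Coding structures by coloured graphs -/

/-- The vertices of the coloured graph coding an `L`-structure with universe `ℕ`: the elements, the
pairs of a relation symbol and a tuple of its arity, the positions in these tuples, and one vertex
marking the tuples for which the relation holds. -/
inductive ModVertex (L : FirstOrder.Language.{0, 0}) : Type
  | elem (a : ℕ) : ModVertex L
  | tuple (t : Σ R : Σ k : ℕ, L.Relations k, Fin R.1 → ℕ) : ModVertex L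
  | pos (t : Σ R : Σ k : ℕ, L.Relations k, Fin R.1 → ℕ) (i : Fin t.1.1) : ModVertex L
  | holds : ModVertex L

namespace ModVertex

variable {L : FirstOrder.Language.{0, 0}}

instance [Countable (Σ k : ℕ, L.Relations k)] : Countable (ModVertex L) := by
  let f : ModVertex L → ℕ ⊕ (Σ R : Σ k : ℕ, L.Relations k, Fin R.1 → ℕ) ⊕
      (Σ t : Σ R : Σ k : ℕ, L.Relations k, Fin R.1 → ℕ, Fin t.1.1) ⊕ Unit
    | elem a => Sum.inl a
    | tuple t => Sum.inr (Sum.inl t)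
    | pos t i => Sum.inr (Sum.inr (Sum.inl ⟨t, i⟩))
    | holds => Sum.inr (Sum.inr (Sum.inr ()))
  refine Function.Injective.countable (f := f) ?_
  rintro (a | t | ⟨t, i⟩ | _) (b | s | ⟨s, j⟩ | _) h <;> simp_all [f]

/-- The colour of a vertex. -/
def kind : ModVertex L →
    Option (Option ((Σ k : ℕ, L.Relations k) ⊕ Σ R : Σ k : ℕ, L.Relations k, Fin R.1))
  | elem _ => none
  | holds => some none
  | tuple t => some (some (Sum.inl t.1))
  | pos t i => some (some (Sum.inr ⟨t.1, i⟩))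

/-- Adjacency in the coloured graph coding a structure: a position is joined to its tuple and to the
element occurring there, and a tuple for which the relation holds to the marking vertex. -/
def Adj (x : ModSpace L) : ModVertex L → ModVertex L → Prop
  | elem a, pos t i => t.2 i = a
  | pos t i, elem a => t.2 i = a
  | tuple s, pos t _ => s = t
  | pos t _, tuple s => s = t
  | tuple t, holds => t.2 ∈ x t.1
  | holds, tuple t => t.2 ∈ x t.1
  | _, _ => False

theorem Adj.symm {x : ModSpace L} {u v : ModVertex L} (h : Adj x u v) : Adj x v u := by
  rcases u with a | t | ⟨t, i⟩ | _ <;> rcases v with b | s | ⟨s, j⟩ | _ <;> exact h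

theorem Adj.kind_ne {x : ModSpace L} {u v : ModVertex L} (h : Adj x u v) : u.kind ≠ v.kind := by
  rcases u with a | t | ⟨t, i⟩ | _ <;> rcases v with b | s | ⟨s, j⟩ | _ <;> simp_all [Adj, kind]

/-- The coloured graph coding a structure. -/
def graph (x : ModSpace L) : SimpleGraph (ModVertex L) where
  Adj := Adj x
  symm := ⟨fun _ _ => Adj.symm⟩
  loopless := ⟨fun _ h => h.kind_ne rfl⟩

/-- Edges run only along the path `elem`, `pos`, `tuple`, `holds` of vertex types, so the graph is
bipartite. -/
theorem graph_cliqueFree (x : ModSpace L) : (graph x).CliqueFree 3 := by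
  classical
  intro s hs
  obtain ⟨u, v, w, huv, huw, hvw, -⟩ := SimpleGraph.is3Clique_iff.1 hs
  change Adj x u v at huv
  change Adj x u w at huw
  change Adj x v w at hvw
  rcases u with a | t | ⟨t, i⟩ | _ <;> rcases v with b | s | ⟨s, j⟩ | _ <;>
    rcases w with c | r | ⟨r, k⟩ | _ <;> simp only [Adj] at huv huw hvw

/-- The map of vertices induced by a map of elements. -/
def map (σ : ℕ → ℕ) : ModVertex L → ModVertex L
  | elem a => elem (σ a)
  | tuple t => tuple ⟨t.1, σ ∘ t.2⟩
  | pos t i => pos ⟨t.1, σ ∘ t.2⟩ i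
  | holds => holds

theorem map_map (σ τ : ℕ → ℕ) (v : ModVertex L) : (v.map σ).map τ = v.map (τ ∘ σ) := by
  cases v <;> rfl

theorem map_id (v : ModVertex L) : v.map id = v := by
  cases v <;> rfl

theorem kind_map (σ : ℕ → ℕ) (v : ModVertex L) : (v.map σ).kind = v.kind := by
  cases v <;> rfl

theorem exists_eq_elem {v : ModVertex L} (h : v.kind = none) : ∃ a, v = elem a := by
  cases v <;> simp_all [kind]

theorem eq_holds {v : ModVertex L} (h : v.kind = some none) : v = holds := by
  cases v <;> simp_all [kind]

theorem exists_eq_tuple {v : ModVertex L} {R : Σ k : ℕ, L.Relations k}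
    (h : v.kind = some (some (Sum.inl R))) : ∃ a, v = tuple ⟨R, a⟩ := by
  cases v with
  | tuple t =>
    simp only [kind, Option.some.injEq, Sum.inl.injEq] at h
    subst h
    exact ⟨t.2, rfl⟩
  | _ => simp [kind] at h

theorem exists_eq_pos {v : ModVertex L} {R : Σ k : ℕ, L.Relations k} {i : Fin R.1}
    (h : v.kind = some (some (Sum.inr ⟨R, i⟩))) : ∃ a, v = pos ⟨R, a⟩ i := by
  cases v with
  | pos t j =>
    obtain ⟨S, a⟩ := t
    simp only [kind, Option.some.injEq, Sum.inr.injEq] at h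
    cases h
    exact ⟨a, rfl⟩
  | _ => simp [kind] at h

/-- A colour-preserving isomorphism permutes the elements, fixes the marking vertex, and keeps
relation symbols and position indices; its action on tuples is therefore forced by its action on
elements. -/
theorem exists_graph_iso_iff {x y : ModSpace L} :
    (∃ e : graph x ≃g graph y, ∀ v, (e v).kind = v.kind) ↔
      ∃ σ : ℕ ≃ ℕ, ∀ R a, σ ∘ a ∈ y R ↔ a ∈ x R := by
  constructor
  · rintro ⟨e, he⟩
    have he' (v : ModVertex L) : (e.symm v).kind = v.kind := by
      rw [← he, e.apply_symm_apply]
    choose f hf using fun a => exists_eq_elem (he (elem a))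
    choose g hg using fun a => exists_eq_elem (he' (elem a))
    refine ⟨⟨f, g, fun a => ?_, fun a => ?_⟩, fun R a => ?_⟩
    · apply elem.inj (L := L)
      rw [← hg, ← hf, e.symm_apply_apply]
    · apply elem.inj (L := L)
      rw [← hf, ← hg, e.apply_symm_apply]
    · have hT := eq_holds (he holds)
      obtain ⟨b, hb⟩ := exists_eq_tuple (he (tuple ⟨R, a⟩))
      -- The image of the `i`-th position is the `i`-th position of the image tuple, and is joined
      -- to the image of the element `a i`.
      have hba : b = f ∘ a := by
        funext i
        obtain ⟨b', hb'⟩ := exists_eq_pos (he (pos ⟨R, a⟩ i))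
        have h1 : (graph y).Adj (e (tuple ⟨R, a⟩)) (e (pos ⟨R, a⟩ i)) :=
          e.map_adj_iff.2 (show Adj x (tuple ⟨R, a⟩) (pos ⟨R, a⟩ i) from rfl)
        have h2 : (graph y).Adj (e (pos ⟨R, a⟩ i)) (e (elem (a i))) :=
          e.map_adj_iff.2 (show Adj x (pos ⟨R, a⟩ i) (elem (a i)) from rfl)
        rw [hb, hb'] at h1
        rw [hb', hf] at h2
        have h1 : (⟨R, b⟩ : Σ R : Σ k : ℕ, L.Relations k, Fin R.1 → ℕ) = ⟨R, b'⟩ := h1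
        have h2 : b' i = f (a i) := h2
        obtain rfl : b = b' := by simpa using h1
        exact h2
      have h : (graph y).Adj (e (tuple ⟨R, a⟩)) (e holds) ↔ _ := e.map_adj_iff
      rw [hb, hT, hba] at h
      exact h
  · rintro ⟨σ, hσ⟩
    refine ⟨⟨⟨map σ, map σ.symm, fun v => ?_, fun v => ?_⟩, fun {u v} => ?_⟩, kind_map σ⟩
    · rw [map_map, σ.symm_comp_self, map_id]
    · rw [map_map, σ.self_comp_symm, map_id]
    · change Adj y (map σ u) (map σ v) ↔ Adj x u v
      have hT (s t : Σ R : Σ k : ℕ, L.Relations k, Fin R.1 → ℕ) :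
          (⟨s.1, σ ∘ s.2⟩ : Σ R : Σ k : ℕ, L.Relations k, Fin R.1 → ℕ) = ⟨t.1, σ ∘ t.2⟩ ↔
            s = t := by
        obtain ⟨R, a⟩ := s
        obtain ⟨S, b⟩ := t
        constructor
        · intro h
          obtain ⟨rfl, h⟩ := Sigma.mk.inj h
          exact congrArg (Sigma.mk R) (σ.injective.comp_left (eq_of_heq h))
        · rintro ⟨⟩
          rfl
      rcases u with a | t | ⟨t, i⟩ | _ <;> rcases v with b | s | ⟨s, j⟩ | _ <;>
        simp [map, Adj, hσ, hT]

theorem measurable_graph_adj (u v : ModVertex L) :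
    Measurable fun x : ModSpace L => (graph x).Adj u v := by
  have h (t : Σ R : Σ k : ℕ, L.Relations k, Fin R.1 → ℕ) :
      Measurable fun x : ModSpace L => t.2 ∈ x t.1 :=
    (measurable_set_mem t.2).comp (measurable_pi_apply t.1)
  rcases u with a | t | ⟨t, i⟩ | _ <;> rcases v with b | s | ⟨s, j⟩ | _ <;>
    first | exact h t | exact h s | exact measurable_const

end ModVertex

theorem ModSpace.isoOn_iff {L : FirstOrder.Language.{0, 0}} [L.IsRelational]
    {C : Set (ModSpace L)} {x y : C} : ModSpace.isoOn C x y ↔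
      ∃ σ : ℕ ≃ ℕ, ∀ R a, σ ∘ a ∈ y.1 R ↔ a ∈ x.1 R := by
  constructor
  · rintro ⟨e⟩
    exact ⟨@FirstOrder.Language.Equiv.toEquiv L ℕ ℕ x.1.toStructure y.1.toStructure e, fun R a =>
      @FirstOrder.Language.Equiv.map_rel' L ℕ ℕ x.1.toStructure y.1.toStructure e _ R.2 a⟩
  · rintro ⟨σ, hσ⟩
    exact ⟨@FirstOrder.Language.Equiv.mk L ℕ ℕ x.1.toStructure y.1.toStructure σ
      (fun f => isEmptyElim f) fun R a => hσ ⟨_, R⟩ a⟩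

/-- Isomorphism of `K_n`-free graphs is Borel complete. -/
theorem borelComplete_kFreeIso {n : ℕ} (hn : 3 ≤ n) : BorelComplete (kFreeIso n) := by
  intro L _ _ C hC
  have : Infinite (HubVertex (ModVertex L)) :=
    Infinite.of_injective HubVertex.hub fun a b h => HubVertex.hub.inj h
  obtain ⟨_⟩ := nonempty_denumerable (HubVertex (ModVertex L))
  let ε : HubVertex (ModVertex L) ≃ ℕ := Denumerable.eqv _
  obtain ⟨k, hk⟩ := exists_injective_nat
    (Option (Option ((Σ k : ℕ, L.Relations k) ⊕ Σ R : Σ k : ℕ, L.Relations k, Fin R.1)))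
  let c : ModVertex L → ℕ := fun v => k v.kind
  let K (x : C) : SimpleGraph (HubVertex (ModVertex L)) := HubVertex.graph c (ModVertex.graph x.1)
  have hK (x : C) : (K x).CliqueFree n :=
    -- Adjacent vertices have different kinds, and `k` is injective, so the colouring `c` is proper;
    -- triangle-free then gives $K_n$-free because $n\ge 3$.
    (HubVertex.graph_cliqueFree (ModVertex.graph_cliqueFree x.1)
      fun u v h => hk.ne h.kind_ne).mono hn
  let i (x : C) : K x ≃g (K x).map ε.toEmbedding := SimpleGraph.Iso.map ε (K x)
  refine ⟨fun x => ⟨(K x).map ε.toEmbedding, (hK x).comap (i x).symm.toCopy.isContained⟩, ?_,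
    fun x y => ?_⟩
  · refine Measurable.subtype_mk (SimpleGraph.measurable_iff_adj.2 fun a b => ?_)
    have : (fun x : C => ((K x).map ε.toEmbedding).Adj a b) =
        fun x => (K x).Adj (ε.symm a) (ε.symm b) := by
      funext x
      rw [← (i x).map_adj_iff]
      simp [i]
    rw [this]
    exact (HubVertex.measurable_graph_adj (X := ModSpace L)
      (fun a b => ModVertex.measurable_graph_adj a b) _ _).comp measurable_subtype_coe
  · have h1 : Nonempty ((K x).map ε.toEmbedding ≃g (K y).map ε.toEmbedding) ↔
        Nonempty (K x ≃g K y) :=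
      ⟨fun ⟨e⟩ => ⟨(i x).trans (e.trans (i y).symm)⟩, fun ⟨e⟩ => ⟨(i x).symm.trans (e.trans (i y))⟩⟩
    rw [ModSpace.isoOn_iff, ← ModVertex.exists_graph_iso_iff]
    refine Iff.trans ?_ h1.symm
    rw [HubVertex.nonempty_graph_iso_iff]
    exact exists_congr fun e => forall_congr' fun v => hk.eq_iff.symm

theorem BorelReducible.trans {X Y Z : Type*} [MeasurableSpace X] [StandardBorelSpace X]
    [MeasurableSpace Y] [StandardBorelSpace Y] [MeasurableSpace Z] [StandardBorelSpace Z]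
    {E : Setoid X} {F : Setoid Y} {D : Setoid Z} (h : BorelReducible E F)
    (h' : BorelReducible F D) : BorelReducible E D := by
  obtain ⟨f, hf, hfE⟩ := h
  obtain ⟨g, hg, hgF⟩ := h'
  exact ⟨g ∘ f, hg.comp hf, fun x x' => (hfE x x').trans (hgF _ _)⟩

theorem mainTheorem1 (n : ℕ) (hn : 3 ≤ n) :
    (∃ Γ : SimpleGraph ℕ, IsGenericKFree n Γ) ∧
    ∀ (V : Type*) [Countable V] (Γ : SimpleGraph V), IsGenericKFree n Γ →
      BorelReducible (kFreeIso n) (autConj Γ) ∧ BorelComplete (autConj Γ) := by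
  refine ⟨exists_isGenericKFree (by omega), fun V _ Γ hΓ => ?_⟩
  have h := kFreeIso_borelReducible_autConj (by omega) hΓ
  refine ⟨h, fun L _ _ C hC => ?_⟩
  have : StandardBorelSpace C := hC.standardBorel
  exact (borelComplete_kFreeIso hn L C hC).trans h
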